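/- Let $N_R,N_T,G,L$ be non-negative integers, $N=\min(N_R,N_T)$, $N_S=GL$, and let $\mathbf H_D\in\mathbb C^{N_R\times N_T}$, $\mathbf H_B\in\mathbb C^{N_R\times N_S}$, $\mathbf H_F\in\mathbb C^{N_S\times N_T}$. For $\mathbf\Theta_1,\dots,\mathbf\Theta_G\in\mathbb C^{L\times L}$ (in particular for unitary ones) put $$\mathbf H=\mathbf H_D+\mathbf H_B\,\mathrm{diag}(\mathbf\Theta_1,\dots,\mathbf\Theta_G)\,\mathbf H_F=\mathbf H_D+\sum_{g=1}^G\mathbf H_{B,g}\mathbf\Theta_g\mathbf H_{F,g},$$ where $\mathbf H_{B,g}$ consists of columns $(g-1)L+1,\dots,gL$ of $\mathbf H_B$ and $\mathbf H_{F,g}$ of the same rows of $\mathbf H_F$. Let $\mathrm{sv}(\mathbf H)=(\sigma_1(\mathbf H),\dots,\sigma_N(\mathbf H))$ be the singular values of $\mathbf H$ in descending order, and let $f:\mathbb R^N\to\mathbb R$ be a symmetric gauge function, that is, a norm invariant under permutations and sign changes of its arguments. Write $\partial f(x)=\{d\in\mathbb R^N: f(y)\ge f(x)+\sum_n d_n(y_n-x_n)\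 \forall y\in\mathbb R^N\}$. For a function $F:\mathbb C^{L\times L}\to\mathbb R$ write $\partial F(\mathbf A)=\{\mathbf S\in\mathbb C^{L\times L}: F(\mathbf X)\ge F(\mathbf A)+\mathrm{Re}\,\mathrm{tr}(\mathbf S^{\mathsf H}(\mathbf X-\mathbf A))\ \forall \mathbf X\in\mathbb C^{L\times L}\}$. Let $\partial_{\mathbf\Theta_g^*}f(\mathrm{sv}(\mathbf H))$ denote the subdifferential, in this sense, at $\mathbf\Theta_g$ of $f(\mathrm{sv}(\mathbf H))$ as a function of the block $\mathbf\Theta_g\in\mathbb C^{L\times L}$, the other blocks being held fixed. **Proposition.** For every $g\in\{1,\dots,G\}$, $$\partial_{\mathbf\Theta_g^*}f(\mathrm{sv}(\mathbf H))=\mathrm{conv}\bigl\{\mathbf H_{B,g}^{\mathsf H}\,\mathbf U\mathbf D\mathbf V^{\mathsf H}\,\mathbf H_{F,g}^{\mathsf H}\bigr\},$$ where $(\mathbf U,\mathbf V)$ ranges over all pairs of left and right singular matrices of $\mathbf H$ (unitary $\mathbf U\in\mathbb C^{N_R\times N_R}$, $\mathbf V\in\mathbb C^{N_T\times N_T}$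 such that $\mathbf H=\mathbf U\mathbf\Sigma\mathbf V^{\mathsf H}$, where $\mathbf\Sigma$ is rectangular diagonal with diagonal $\mathrm{sv}(\mathbf H)$), and $\mathbf D\in\mathbb C^{N_R\times N_T}$ ranges over the rectangular diagonal matrices whose diagonal $([\mathbf D]_{1,1},\dots,[\mathbf D]_{N,N})$ belongs to $\partial f(\mathrm{sv}(\mathbf H))$. -/

import Mathlib

open scoped Matrix

noncomputable section

namespace RISShaping

/-- A symmetric gauge function on `ℝ^N`: a norm that is invariant under permutations of the
arguments and under changes of their signs. -/
structure IsSymmetricGauge {N : ℕ} (f : (Fin N → ℝ) → ℝ) : Prop where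
  add_le : ∀ x y, f (x + y) ≤ f x + f y
  smul : ∀ (c : ℝ) (x), f (c • x) = |c| * f x
  eq_zero : ∀ x, f x = 0 → x = 0
  perm : ∀ (π : Equiv.Perm (Fin N)) (x), f (x ∘ π) = f x
  sign : ∀ (ε : Fin N → ℝ), (∀ n, ε n = 1 ∨ ε n = -1) → ∀ x, f (fun n => ε n * x n) = f x

/-- The singular values `σ₁(H) ≥ σ₂(H) ≥ …` of an `NR × NT` matrix, as a vector of length
`min NR NT`. -/
def sv {NR NT : ℕ} (H : Matrix (Fin NR) (Fin NT) ℂ) : Fin (min NR NT) → ℝ :=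
  fun n => (Matrix.toEuclideanLin H).singularValues n

/-- The rectangular diagonal matrix with diagonal entries `d`. -/
def rectDiag {NR NT : ℕ} (d : Fin (min NR NT) → ℝ) : Matrix (Fin NR) (Fin NT) ℂ :=
  Matrix.of fun i j =>
    if h : (i : ℕ) = (j : ℕ) then ((d ⟨i, lt_min i.isLt (h ▸ j.isLt)⟩ : ℝ) : ℂ) else 0

/-- `U` and `V` are left and right singular matrices of `H`: they are unitary and
`H = U Σ Vᴴ` with `Σ` carrying the singular values of `H` in descending order. -/
def IsSVD {NR NT : ℕ} (H : Matrix (Fin NR) (Fin NT) ℂ) (U : Matrix (Fin NR) (Fin NR) ℂ)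
    (V : Matrix (Fin NT) (Fin NT) ℂ) : Prop :=
  U ∈ Matrix.unitaryGroup (Fin NR) ℂ ∧ V ∈ Matrix.unitaryGroup (Fin NT) ℂ ∧
    H = U * rectDiag (sv H) * Vᴴ

/-- The subdifferential of a function on `ℝ^N` at `x`. -/
def vecSubdifferential {N : ℕ} (f : (Fin N → ℝ) → ℝ) (x : Fin N → ℝ) : Set (Fin N → ℝ) :=
  {d | ∀ y, f x + ∑ n, d n * (y n - x n) ≤ f y}

/-- The subdifferential of a real function of a complex matrix at `A`, with respect to the real
inner product `⟨S, X⟩ = Re tr(Sᴴ X)`. -/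
def matSubdifferential {m n : ℕ} (F : Matrix (Fin m) (Fin n) ℂ → ℝ)
    (A : Matrix (Fin m) (Fin n) ℂ) : Set (Matrix (Fin m) (Fin n) ℂ) :=
  {S | ∀ X, F A + (Matrix.trace (Sᴴ * (X - A))).re ≤ F X}

/-- The block-diagonal scattering matrix `diag(Θ₁, …, Θ_G)` with `L × L` blocks; the element `l`
of group `g` has (zero-based) position `l + L * g`. -/
def scattering {G L : ℕ} (Θ : Fin G → Matrix (Fin L) (Fin L) ℂ) :
    Matrix (Fin (G * L)) (Fin (G * L)) ℂ :=
  Matrix.of fun s t =>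
    if (finProdFinEquiv.symm s).1 = (finProdFinEquiv.symm t).1 then
      Θ (finProdFinEquiv.symm s).1 (finProdFinEquiv.symm s).2 (finProdFinEquiv.symm t).2
    else 0

/-- The equivalent channel `H = H_D + H_B Θ H_F`. -/
def channel {NR NT G L : ℕ} (HD : Matrix (Fin NR) (Fin NT) ℂ)
    (HB : Matrix (Fin NR) (Fin (G * L)) ℂ) (HF : Matrix (Fin (G * L)) (Fin NT) ℂ)
    (Θ : Fin G → Matrix (Fin L) (Fin L) ℂ) : Matrix (Fin NR) (Fin NT) ℂ :=
  HD + HB * scattering Θ * HF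

/-- The backward channel of group `g`: its `L` consecutive columns of `H_B`. -/
def backward {NR G L : ℕ} (HB : Matrix (Fin NR) (Fin (G * L)) ℂ) (g : Fin G) :
    Matrix (Fin NR) (Fin L) ℂ :=
  HB.submatrix id fun l => finProdFinEquiv (g, l)

/-- The forward channel of group `g`: its `L` consecutive rows of `H_F`. -/
def forward {NT G L : ℕ} (HF : Matrix (Fin (G * L)) (Fin NT) ℂ) (g : Fin G) :
    Matrix (Fin L) (Fin NT) ℂ :=
  HF.submatrix (fun l => finProdFinEquiv (g, l)) id

end RISShaping

end

/-! Varying one block moves the channel along an affine map `X ↦ H + B (X - A) F`, so it suffices to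
treat that map; the factors `Bᴴ` and `Fᴴ` appear by moving `B` and `F` to the other side of the
trace pairing.

One inclusion is a trace inequality of von Neumann type: if `d` lies in the dual unit ball of `f`,
then `U D Vᴴ` pairs with every `Z` to at most `f (sv Z)` (`IsSymmetricGauge.re_trace_le`). If
moreover `d` is a subgradient at `sv H` and `U`, `V` are singular matrices of `H`, the bound is
attained at `H`, so `U D Vᴴ` is a subgradient of `f ∘ sv` there. Subdifferentials are convex, so the
hull follows.

For the other inclusion, a subgradient `S` outside the hull is strictly separated from it by a
functional `φ`, which is pairing with some `Y`. The hull is closed because the admissible triples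
`(U, V, d)` form a compact set. Put `Z = B Y F`. Comparing the inequality for `S` at `H` with that
for a subgradient `U D Vᴴ` at `H + t Z` gives `φ S ≤ φ (Bᴴ U D Vᴴ Fᴴ)` for each `t > 0`. As `t → 0`,
a subsequence of triples converges to an admissible triple at `H` (`exists_subseq_svd`),
contradicting the separation. -/

namespace RISShaping

/-! ### Convex hulls and doubly stochastic matrices -/

/-- In a finite-dimensional space the convex hull of a compact set is compact. -/
theorem isCompact_convexHull {E : Type*} [AddCommGroup E] [Module ℝ E] [TopologicalSpace E]
    [ContinuousAdd E] [ContinuousSMul ℝ E] [FiniteDimensional ℝ E] {K : Set E}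
    (hK : IsCompact K) : IsCompact (convexHull ℝ K) := by
  rcases K.eq_empty_or_nonempty with rfl | ⟨k, hk⟩
  · simp
  -- By Carathéodory, `m` points suffice, so the hull is a continuous image of simplex times `K ^
  -- m`. Shorter combinations are padded with weight 0 at the point `k`.
  set m := Module.finrank ℝ E + 1
  have hc : IsCompact ((stdSimplex ℝ (Fin m)) ×ˢ (Set.univ.pi fun _ : Fin m => K)) :=
    (isCompact_stdSimplex ℝ (Fin m)).prod (isCompact_univ_pi fun _ => hK)
  convert hc.image (f := fun p : (Fin m → ℝ) × (Fin m → E) => ∑ i, p.1 i • p.2 i) (by fun_prop)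
  apply Set.Subset.antisymm
  · intro x hx
    obtain ⟨ι, _, z, w, hz, hind, hw, hw1, rfl⟩ := eq_pos_convex_span_of_mem_convexHull hx
    have hcard : Fintype.card ι ≤ Fintype.card (Fin m) := by
      rw [Fintype.card_fin]
      exact hind.card_le_finrank_succ.trans
        (Nat.add_le_add_right (Submodule.finrank_le _) 1)
    obtain ⟨e⟩ := Function.Embedding.nonempty_of_card_le hcard
    have hw' : ∀ i, Function.extend e w 0 (e i) = w i := e.injective.extend_apply w 0
    have hz' : ∀ i, Function.extend e z (fun _ => k) (e i) = z i := e.injective.extend_apply z _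
    have hout : ∀ j, j ∉ Set.range e → Function.extend e w 0 j = 0 := fun j hj =>
      Function.extend_apply' _ _ _ hj
    refine ⟨(Function.extend e w 0, Function.extend e z fun _ => k), ⟨⟨?_, ?_⟩, ?_⟩, ?_⟩
    · intro j
      by_cases hj : j ∈ Set.range e
      · obtain ⟨i, rfl⟩ := hj
        exact (hw i).le.trans_eq (hw' i).symm
      · exact (hout j hj).ge
    · rw [← hw1]
      exact (Fintype.sum_of_injective e e.injective _ _ hout fun i => (hw' i).symm).symm
    · intro j _
      by_cases hj : j ∈ Set.range e
      · obtain ⟨i, rfl⟩ := hj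
        change Function.extend e z (fun _ => k) (e i) ∈ K
        rw [hz']
        exact hz ⟨i, rfl⟩
      · change Function.extend e z (fun _ => k) j ∈ K
        rw [Function.extend_apply' _ _ _ hj]
        exact hk
    · refine (Fintype.sum_of_injective e e.injective _ _ (fun j hj => ?_) fun i => ?_).symm
      · simp [hout j hj]
      · simp [hw', hz']
  · rintro _ ⟨⟨w, z⟩, ⟨hw, hz⟩, rfl⟩
    exact (convex_convexHull ℝ K).sum_mem (fun i _ => hw.1 i) hw.2
      fun i _ => subset_convexHull ℝ K (hz i trivial)

/-- A nonnegative doubly substochastic matrix is dominated entrywise by a doubly stochastic one. -/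
theorem exists_doublyStochastic_ge {n : Type*} [Fintype n] [DecidableEq n] (A : Matrix n n ℝ)
    (h0 : ∀ i k, 0 ≤ A i k) (hr : ∀ i, ∑ k, A i k ≤ 1) (hc : ∀ k, ∑ i, A i k ≤ 1) :
    ∃ Q ∈ doublyStochastic ℝ n, ∀ i k, A i k ≤ Q i k := by
  set r : n → ℝ := fun i => 1 - ∑ k, A i k with hrdef
  set c : n → ℝ := fun k => 1 - ∑ i, A i k with hcdef
  have hr0 : ∀ i, 0 ≤ r i := fun i => sub_nonneg.2 (hr i)
  have hc0 : ∀ i, 0 ≤ c i := fun i => sub_nonneg.2 (hc i)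
  have hs : ∑ i, r i = ∑ k, c k := by
    simp only [hrdef, hcdef, Finset.sum_sub_distrib]
    rw [Finset.sum_comm]
  have hs0 : 0 ≤ ∑ i, r i := Finset.sum_nonneg fun i _ => hr0 i
  -- If the total deficiency vanishes, so does each `r i`, and division by zero is harmless.
  have hdr : ∀ i, r i * (∑ k, c k) / (∑ i, r i) = r i := by
    intro i
    rw [← hs]
    rcases hs0.eq_or_lt with h | h
    · rw [(Finset.sum_eq_zero_iff_of_nonneg fun i _ => hr0 i).1 h.symm i (Finset.mem_univ i)]
      simp
    · field_simp
  have hdc : ∀ k, (∑ i, r i) * c k / (∑ i, r i) = c k := by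
    intro k
    rcases hs0.eq_or_lt with h | h
    · rw [(Finset.sum_eq_zero_iff_of_nonneg fun i _ => hc0 i).1 (hs ▸ h.symm) k
        (Finset.mem_univ k)]
      simp
    · field_simp
  -- A nonnegative rank-one correction repairs all row and column deficiencies at once, as their
  -- totals agree.
  refine ⟨Matrix.of fun i k => A i k + r i * c k / ∑ i, r i, ?_, ?_⟩
  · rw [mem_doublyStochastic_iff_sum]
    refine ⟨fun i k => ?_, fun i => ?_, fun k => ?_⟩
    · exact add_nonneg (h0 i k) (div_nonneg (mul_nonneg (hr0 i) (hc0 k)) hs0)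
    · simp only [Matrix.of_apply, Finset.sum_add_distrib]
      rw [← Finset.sum_div, ← Finset.mul_sum, hdr]
      simp [hrdef]
    · simp only [Matrix.of_apply, Finset.sum_add_distrib]
      rw [← Finset.sum_div, ← Finset.sum_mul, hdc]
      simp [hcdef]
  · intro i k
    exact le_add_of_nonneg_right (div_nonneg (mul_nonneg (hr0 i) (hc0 k)) hs0)

/-! ### Symmetric gauge functions and their subgradients -/

namespace IsSymmetricGauge

variable {N : ℕ} {f : (Fin N → ℝ) → ℝ}

theorem map_zero (hf : IsSymmetricGauge f) : f 0 = 0 := by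
  simpa using hf.smul 0 0

theorem map_neg (hf : IsSymmetricGauge f) (x : Fin N → ℝ) : f (-x) = f x := by
  simpa using hf.smul (-1) x

theorem continuous (hf : IsSymmetricGauge f) : Continuous f := by
  let p : Seminorm ℝ (Fin N → ℝ) := Seminorm.of f hf.add_le hf.smul
  have hp : ConvexOn ℝ Set.univ f := p.convexOn
  exact continuousOn_univ.1 (hp.continuousOn isOpen_univ)

/-- Homogeneity splits the subgradient inequality: testing at `0` and at `2 x` forces equality at
`x`, and what remains is membership in the dual unit ball. -/
theorem mem_vecSubdifferential_iff (hf : IsSymmetricGauge f) {x d : Fin N → ℝ} :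
    d ∈ vecSubdifferential f x ↔ (∀ y, ∑ n, d n * y n ≤ f y) ∧ ∑ n, d n * x n = f x := by
  constructor
  · intro hd
    have hlin : ∀ y, f x + (∑ n, d n * y n - ∑ n, d n * x n) ≤ f y := by
      intro y
      rw [← Finset.sum_sub_distrib]
      simpa only [mul_sub] using hd y
    have h1 := hlin 0
    have h2 := hlin ((2 : ℝ) • x)
    rw [hf.smul] at h2
    simp only [Pi.smul_apply, smul_eq_mul, mul_left_comm _ (2 : ℝ), ← Finset.mul_sum] at h2
    rw [hf.map_zero] at h1
    simp only [Pi.zero_apply, mul_zero, Finset.sum_const_zero] at h1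
    rw [abs_of_pos (by norm_num : (0 : ℝ) < 2)] at h2
    have hx : ∑ n, d n * x n = f x := by linarith
    exact ⟨fun y => by linarith [hlin y], hx⟩
  · rintro ⟨hd, hx⟩ y
    simp only [mul_sub, Finset.sum_sub_distrib]
    linarith [hd y]

/-- Hahn–Banach: extend `c x ↦ c * f x` from the line through `x`, dominated by `f`. At `x = 0` the
zero functional serves. -/
theorem vecSubdifferential_nonempty (hf : IsSymmetricGauge f) (x : Fin N → ℝ) :
    (vecSubdifferential f x).Nonempty := by
  have key : ∃ φ : (Fin N → ℝ) →ₗ[ℝ] ℝ, φ x = f x ∧ ∀ y, φ y ≤ f y := by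
    by_cases hx : x = 0
    · refine ⟨0, by simp [hx, hf.map_zero], fun y => ?_⟩
      have := hf.add_le y (-y)
      rw [hf.map_neg, add_neg_cancel, hf.map_zero] at this
      change (0 : ℝ) ≤ f y
      linarith
    · obtain ⟨φ, h1, h2⟩ := exists_extension_of_le_sublinear
        (LinearPMap.mkSpanSingleton x (f x) hx) f
        (fun c hc y => by rw [hf.smul, abs_of_pos hc]) hf.add_le (by
          rintro ⟨y, hy⟩
          obtain ⟨c, rfl⟩ := Submodule.mem_span_singleton.1 hy
          rw [LinearPMap.mkSpanSingleton'_apply, hf.smul, smul_eq_mul]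
          have h0 : 0 ≤ f x := by
            have := hf.add_le x (-x)
            rw [hf.map_neg, add_neg_cancel, hf.map_zero] at this
            linarith
          exact mul_le_mul_of_nonneg_right (le_abs_self c) h0)
      refine ⟨φ, ?_, h2⟩
      exact (h1 ⟨x, Submodule.mem_span_singleton_self x⟩).trans
        (LinearPMap.mkSpanSingleton_apply ℝ ℝ hx (f x))
  obtain ⟨φ, h1, h2⟩ := key
  have hφ : ∀ y, ∑ n, φ (Pi.single n 1) * y n = φ y := by
    intro y
    conv_rhs => rw [pi_eq_sum_univ' y, map_sum]
    refine Finset.sum_congr rfl fun n _ => ?_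
    rw [map_smul, smul_eq_mul, mul_comm]
  exact ⟨fun n => φ (Pi.single n 1), hf.mem_vecSubdifferential_iff.2
    ⟨fun y => (hφ y).trans_le (h2 y), (hφ x).trans h1⟩⟩

/-- A vector of the dual unit ball pairs with `Q σ`, for `Q` doubly stochastic, to at most `f σ`. -/
theorem sum_abs_mul_le (hf : IsSymmetricGauge f) {d : Fin N → ℝ}
    (hd : ∀ y, ∑ n, d n * y n ≤ f y) {Q : Matrix (Fin N) (Fin N) ℝ}
    (hQ : Q ∈ doublyStochastic ℝ (Fin N)) (σ : Fin N → ℝ) :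
    ∑ i, ∑ k, |d i| * Q i k * σ k ≤ f σ := by
  let ε : Fin N → ℝ := fun i => if 0 ≤ d i then 1 else -1
  have hε : ∀ i, |d i| = d i * ε i := by
    intro i
    by_cases h : 0 ≤ d i
    · simp [ε, h, abs_of_nonneg h]
    · simp [ε, h, abs_of_neg (not_le.1 h)]
  let φ : Matrix (Fin N) (Fin N) ℝ →ₗ[ℝ] ℝ :=
    { toFun := fun Q => ∑ i, ∑ k, |d i| * Q i k * σ k
      map_add' := fun A B => by
        simp only [Matrix.add_apply, mul_add, add_mul, Finset.sum_add_distrib]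
      map_smul' := fun c A => by
        simp only [Matrix.smul_apply, smul_eq_mul, Finset.mul_sum, RingHom.id_apply]
        refine Finset.sum_congr rfl fun i _ => Finset.sum_congr rfl fun k _ => by ring }
  -- By Birkhoff it is enough to check permutation matrices, since the bound cuts out a half-space;
  -- there, permutation and sign invariance reduce it to `hd`.
  have hsub : (doublyStochastic ℝ (Fin N) : Set (Matrix (Fin N) (Fin N) ℝ)) ⊆
      {A | φ A ≤ f σ} := by
    rw [doublyStochastic_eq_convexHull_permMatrix]
    refine convexHull_min ?_ (convex_halfSpace_le φ.isLinear _)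
    rintro _ ⟨π, rfl⟩
    change ∑ i, ∑ k, |d i| * (Equiv.Perm.permMatrix ℝ π) i k * σ k ≤ f σ
    have h1 : ∀ i, ∑ k, |d i| * (Equiv.Perm.permMatrix ℝ π) i k * σ k
        = d i * (ε i * (σ ∘ π) i) := by
      intro i
      rw [Finset.sum_eq_single (π i)]
      · simp [hε, mul_assoc, PEquiv.toMatrix_apply]
      · intro b _ hb
        simp [PEquiv.toMatrix_apply, hb.symm]
      · simp
    rw [Finset.sum_congr rfl fun i _ => h1 i, ← hf.perm π σ,
      ← hf.sign ε (fun i => by by_cases h : 0 ≤ d i <;> simp [ε, h]) (σ ∘ π)]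
    exact hd _
  exact hsub hQ

theorem isCompact_dualBall (hf : IsSymmetricGauge f) :
    IsCompact {d : Fin N → ℝ | ∀ y, ∑ n, d n * y n ≤ f y} := by
  refine IsCompact.of_isClosed_subset
    (isCompact_univ_pi fun n : Fin N => isCompact_Icc (a := -f (Pi.single n 1))
      (b := f (Pi.single n 1))) ?_ ?_
  · simp only [Set.ofPred_forall]
    exact isClosed_iInter fun y => isClosed_le (by fun_prop) continuous_const
  -- Testing on `± e_n` bounds each coordinate by `f e_n`.
  · intro d hd n _
    have h1 := hd (Pi.single n 1)
    have h2 := hd (-Pi.single n 1)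
    rw [hf.map_neg] at h2
    simp [Pi.single_apply] at h1 h2
    exact ⟨by linarith, h1⟩

end IsSymmetricGauge

/-! ### Rectangular diagonal matrices and the diagonal trace bound -/

variable {NR NT : ℕ}

/-- The `n`-th diagonal row index. -/
def rowIdx (NR NT : ℕ) (n : Fin (min NR NT)) : Fin NR := Fin.castLE (min_le_left NR NT) n

/-- The `n`-th diagonal column index. -/
def colIdx (NR NT : ℕ) (n : Fin (min NR NT)) : Fin NT := Fin.castLE (min_le_right NR NT) n

theorem rowIdx_injective : Function.Injective (rowIdx NR NT) :=
  Fin.castLE_injective (min_le_left NR NT)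

theorem colIdx_injective : Function.Injective (colIdx NR NT) :=
  Fin.castLE_injective (min_le_right NR NT)

theorem rectDiag_eq_sum (d : Fin (min NR NT) → ℝ) :
    rectDiag d = ∑ n, Matrix.single (rowIdx NR NT n) (colIdx NR NT n) ((d n : ℝ) : ℂ) := by
  ext i j
  rw [Matrix.sum_apply]
  simp only [rectDiag, Matrix.of_apply, Matrix.single_apply]
  split_ifs with h
  · rw [Finset.sum_eq_single ⟨i, lt_min i.isLt (h ▸ j.isLt)⟩]
    · rw [if_pos]
      exact ⟨Fin.ext rfl, Fin.ext h⟩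
    · intro b _ hb
      rw [if_neg]
      rintro ⟨h1, -⟩
      have h2 : (b : ℕ) = i := congrArg (fun a : Fin NR => (a : ℕ)) h1
      exact hb (Fin.ext h2)
    · simp
  · refine (Finset.sum_eq_zero fun n _ => if_neg ?_).symm
    rintro ⟨rfl, rfl⟩
    exact h rfl

theorem mul_rectDiag_mul_apply {m n : Type*} (W : Matrix m (Fin NR) ℂ)
    (X : Matrix (Fin NT) n ℂ) (σ : Fin (min NR NT) → ℝ) (i : m) (j : n) :
    (W * rectDiag σ * X) i j =
      ∑ k, W i (rowIdx NR NT k) * (σ k : ℂ) * X (colIdx NR NT k) j := by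
  rw [rectDiag_eq_sum, Matrix.mul_sum, Matrix.sum_mul, Matrix.sum_apply]
  refine Finset.sum_congr rfl fun k _ => ?_
  rw [Matrix.mul_apply, Finset.sum_eq_single (colIdx NR NT k)]
  · simp
  · intro b _ hb
    rw [Matrix.mul_single_apply_of_ne _ _ _ _ _ hb, zero_mul]
  · simp

theorem rectDiag_apply_idx (d : Fin (min NR NT) → ℝ) (n : Fin (min NR NT)) :
    (rectDiag d : Matrix (Fin NR) (Fin NT) ℂ) (rowIdx NR NT n) (colIdx NR NT n) = d n := by
  simp [rectDiag, rowIdx, colIdx]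

theorem trace_conjTranspose_rectDiag_mul (d : Fin (min NR NT) → ℝ)
    (M : Matrix (Fin NR) (Fin NT) ℂ) :
    Matrix.trace ((rectDiag d)ᴴ * M) =
      ∑ n, (d n : ℂ) * M (rowIdx NR NT n) (colIdx NR NT n) := by
  rw [rectDiag_eq_sum, Matrix.conjTranspose_sum, Matrix.sum_mul, Matrix.trace_sum]
  refine Finset.sum_congr rfl fun k _ => ?_
  rw [Matrix.conjTranspose_single, Matrix.trace_single_mul]
  simp

theorem continuous_rectDiag :
    Continuous (rectDiag : (Fin (min NR NT) → ℝ) → Matrix (Fin NR) (Fin NT) ℂ) := by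
  refine continuous_matrix fun i j => ?_
  simp only [rectDiag, Matrix.of_apply]
  split_ifs
  · exact Complex.continuous_ofReal.comp (continuous_apply _)
  · exact continuous_const

theorem sum_normSq_row {n : ℕ} {U : Matrix (Fin n) (Fin n) ℂ}
    (hU : U ∈ Matrix.unitaryGroup (Fin n) ℂ) (i : Fin n) : ∑ k, ‖U i k‖ ^ 2 = 1 := by
  have h := congrFun (congrFun (Matrix.mem_unitaryGroup_iff.1 hU) i) i
  rw [Matrix.mul_apply, Matrix.one_apply_eq] at h
  have h' := congrArg Complex.re h
  simpa [Matrix.star_apply, Complex.mul_conj, Complex.normSq_eq_norm_sq, ← Complex.ofReal_pow]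
    using h'

theorem sum_normSq_col {n : ℕ} {U : Matrix (Fin n) (Fin n) ℂ}
    (hU : U ∈ Matrix.unitaryGroup (Fin n) ℂ) (k : Fin n) : ∑ i, ‖U i k‖ ^ 2 = 1 := by
  have h := sum_normSq_row (Unitary.star_mem hU) k
  simpa [Matrix.star_apply] using h

/-- Restricting a sum of nonnegative terms along an injection does not increase it. -/
theorem sum_comp_le_of_injective {a b : Type*} [Fintype a] [Fintype b] {e : a → b}
    (he : Function.Injective e) {w : b → ℝ} (hw : ∀ j, 0 ≤ w j) :
    ∑ i, w (e i) ≤ ∑ j, w j := by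
  classical
  rw [← Finset.sum_image (f := w) (s := Finset.univ) (g := e) he.injOn]
  exact Finset.sum_le_sum_of_subset_of_nonneg (Finset.subset_univ _) fun j _ _ => hw j

/-- The trace expands into terms `d i * W i k * σ k * X k i`. By AM-GM, `‖W i k‖ * ‖X k i‖` is at
most the mean of the squares, and these means form a doubly substochastic matrix because `W` and `X`
are unitary. A doubly stochastic majorant then brings in `sum_abs_mul_le`. -/
theorem IsSymmetricGauge.re_trace_rectDiag_le {f : (Fin (min NR NT) → ℝ) → ℝ}
    (hf : IsSymmetricGauge f) {d σ : Fin (min NR NT) → ℝ}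
    (hd : ∀ y, ∑ n, d n * y n ≤ f y) (hσ : ∀ n, 0 ≤ σ n)
    {W : Matrix (Fin NR) (Fin NR) ℂ} (hW : W ∈ Matrix.unitaryGroup (Fin NR) ℂ)
    {X : Matrix (Fin NT) (Fin NT) ℂ} (hX : X ∈ Matrix.unitaryGroup (Fin NT) ℂ) :
    (Matrix.trace ((rectDiag d)ᴴ * (W * rectDiag σ * X))).re ≤ f σ := by
  let r := rowIdx NR NT
  let c := colIdx NR NT
  obtain ⟨Q, hQ, hAQ⟩ := exists_doublyStochastic_ge
    (Matrix.of fun i k => (‖W (r i) (r k)‖ ^ 2 + ‖X (c k) (c i)‖ ^ 2) / 2)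
    (fun i k => by simp only [Matrix.of_apply]; positivity)
    (fun i => by
      simp only [Matrix.of_apply]
      rw [← Finset.sum_div, Finset.sum_add_distrib]
      have h1 := sum_comp_le_of_injective (rowIdx_injective (NR := NR) (NT := NT))
        (w := fun k => ‖W (r i) k‖ ^ 2) fun _ => by positivity
      have h2 := sum_comp_le_of_injective (colIdx_injective (NR := NR) (NT := NT))
        (w := fun k => ‖X k (c i)‖ ^ 2) fun _ => by positivity
      rw [sum_normSq_row hW] at h1
      rw [sum_normSq_col hX] at h2
      linarith)
    (fun k => by
      simp only [Matrix.of_apply]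
      rw [← Finset.sum_div, Finset.sum_add_distrib]
      have h1 := sum_comp_le_of_injective (rowIdx_injective (NR := NR) (NT := NT))
        (w := fun i => ‖W i (r k)‖ ^ 2) fun _ => by positivity
      have h2 := sum_comp_le_of_injective (colIdx_injective (NR := NR) (NT := NT))
        (w := fun i => ‖X (c k) i‖ ^ 2) fun _ => by positivity
      rw [sum_normSq_col hW] at h1
      rw [sum_normSq_row hX] at h2
      linarith)
  refine le_trans ?_ (hf.sum_abs_mul_le hd hQ σ)
  rw [trace_conjTranspose_rectDiag_mul, Complex.re_sum]
  refine Finset.sum_le_sum fun i _ => ?_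
  rw [mul_rectDiag_mul_apply, Finset.mul_sum, Complex.re_sum]
  refine Finset.sum_le_sum fun k _ => ?_
  have h3 : ‖W (r i) (r k)‖ * ‖X (c k) (c i)‖ ≤ Q i k := by
    refine le_trans ?_ (hAQ i k)
    simp only [Matrix.of_apply]
    nlinarith [sq_nonneg (‖W (r i) (r k)‖ - ‖X (c k) (c i)‖)]
  refine (Complex.re_le_norm _).trans ?_
  rw [norm_mul, norm_mul, norm_mul, Complex.norm_real, Complex.norm_real, Real.norm_eq_abs,
    Real.norm_eq_abs, abs_of_nonneg (hσ k)]
  calc |d i| * (‖W (r i) (r k)‖ * σ k * ‖X (c k) (c i)‖)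
      = |d i| * (‖W (r i) (r k)‖ * ‖X (c k) (c i)‖) * σ k := by ring
    _ ≤ |d i| * Q i k * σ k := by gcongr; exact hσ k

theorem isCompact_unitaryGroup (n : ℕ) :
    IsCompact (Matrix.unitaryGroup (Fin n) ℂ : Set (Matrix (Fin n) (Fin n) ℂ)) := by
  refine IsCompact.of_isClosed_subset
    (isCompact_univ_pi fun _ : Fin n => isCompact_univ_pi fun _ : Fin n =>
      isCompact_closedBall (0 : ℂ) 1) ?_ ?_
  · have : (Matrix.unitaryGroup (Fin n) ℂ : Set (Matrix (Fin n) (Fin n) ℂ)) =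
        {U | U * star U = 1} := Set.ext fun U => Matrix.mem_unitaryGroup_iff
    rw [this]
    exact isClosed_eq (by fun_prop) continuous_const
  · intro U hU i _ j _
    simpa using entry_norm_bound_of_unitary hU i j

/-! ### Existence and uniqueness of singular value decompositions -/

theorem sv_nonneg (H : Matrix (Fin NR) (Fin NT) ℂ) (n : Fin (min NR NT)) : 0 ≤ sv H n :=
  LinearMap.singularValues_nonneg _ _

theorem sv_antitone (H : Matrix (Fin NR) (Fin NT) ℂ) : Antitone (sv H) := fun _ _ h =>
  LinearMap.singularValues_antitone _ h

theorem OrthonormalBasis.of_mem_unitaryGroup {n : ℕ}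
    (b : OrthonormalBasis (Fin n) ℂ (EuclideanSpace ℂ (Fin n))) :
    (Matrix.of fun i j => b j i) ∈ Matrix.unitaryGroup (Fin n) ℂ := by
  rw [Matrix.mem_unitaryGroup_iff']
  ext i j
  have h := orthonormal_iff_ite.1 b.orthonormal i j
  rw [PiLp.inner_apply] at h
  rw [Matrix.mul_apply, Matrix.one_apply, ← h]
  refine Finset.sum_congr rfl fun k _ => ?_
  simp [Matrix.star_apply, mul_comm]

/-- Every matrix has a singular value decomposition. -/
theorem exists_isSVD (H : Matrix (Fin NR) (Fin NT) ℂ) : ∃ U V, IsSVD H U V := by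
  set T := Matrix.toEuclideanLin H with hT
  have hn : Module.finrank ℂ (EuclideanSpace ℂ (Fin NT)) = NT := finrank_euclideanSpace_fin
  let b := T.isSymmetric_adjoint_comp_self.eigenvectorBasis hn
  let σ : ℕ → ℝ := T.singularValues
  have hinner : ∀ i j, inner ℂ (T (b i)) (T (b j)) = if i = j then ((σ j : ℂ)) ^ 2 else 0 := by
    intro i j
    have h1 := T.isSymmetric_adjoint_comp_self.apply_eigenvectorBasis hn j
    rw [LinearMap.comp_apply, ← T.sq_singularValues_fin hn j] at h1
    rw [← LinearMap.adjoint_inner_right, h1, inner_smul_right, orthonormal_iff_ite.1 b.orthonormal]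
    split_ifs <;> simp [σ]
  have hker : ∀ j : Fin NT, σ j = 0 → T (b j) = 0 := by
    intro j hj
    have := hinner j j
    rw [if_pos rfl, hj] at this
    simpa using this
  -- The images of the eigenvectors of `T* T` are orthogonal with norms `σ i`. Only the indices in
  -- `s` are normalized; the other columns of `U` come from an arbitrary orthonormal completion, as
  -- they never meet a nonzero singular value.
  let v : Fin NR → EuclideanSpace ℂ (Fin NR) := fun i =>
    if h : (i : ℕ) < NT then ((σ i : ℂ))⁻¹ • T (b ⟨i, h⟩) else 0
  let s : Set (Fin NR) := {i | (i : ℕ) < NT ∧ σ i ≠ 0}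
  have hv : Orthonormal ℂ (s.domRestrict v) := by
    rw [orthonormal_iff_ite]
    rintro ⟨i, hi, hi0⟩ ⟨j, hj, hj0⟩
    change inner ℂ (v i) (v j) = _
    simp only [v, dif_pos hi, dif_pos hj, inner_smul_left, inner_smul_right,
      hinner, Subtype.mk.injEq, Fin.ext_iff]
    split_ifs with h
    · have : (σ j : ℂ) ≠ 0 := by exact_mod_cast hj0
      rw [h]
      simp
      field_simp
    · simp
  obtain ⟨u, hu⟩ := hv.exists_orthonormalBasis_extension_of_card_eq (by simp)
  let U : Matrix (Fin NR) (Fin NR) ℂ := Matrix.of fun i j => u j i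
  let V : Matrix (Fin NT) (Fin NT) ℂ := Matrix.of fun i j => b j i
  have hU : U ∈ Matrix.unitaryGroup (Fin NR) ℂ := OrthonormalBasis.of_mem_unitaryGroup u
  have hV : V ∈ Matrix.unitaryGroup (Fin NT) ℂ := OrthonormalBasis.of_mem_unitaryGroup b
  refine ⟨U, V, hU, hV, ?_⟩
  have key : H * V = U * rectDiag (sv H) := by
    ext i j
    have hL : (H * V) i j = T (b j) i := by
      simp [hT, Matrix.mul_apply, V, Matrix.toLpLin_apply, Matrix.mulVec, dotProduct]
    rw [hL, ← Matrix.mul_one (U * rectDiag (sv H)), mul_rectDiag_mul_apply]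
    by_cases hj : (j : ℕ) < NR
    · have hcol : ∀ k, colIdx NR NT k = j ↔ k = ⟨j, lt_min hj j.isLt⟩ := fun k => by
        simp [colIdx, Fin.ext_iff]
      simp only [Matrix.one_apply, hcol, mul_ite, mul_one, mul_zero, Finset.sum_ite_eq',
        Finset.mem_univ, if_true]
      change T (b j) i = u ⟨j, hj⟩ i * (σ j : ℂ)
      by_cases h0 : σ j = 0
      · simp [h0, hker j h0]
      · have h0' : (σ j : ℂ) ≠ 0 := by exact_mod_cast h0
        rw [hu ⟨j, hj⟩ ⟨j.isLt, h0⟩]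
        simp only [v, dif_pos j.isLt, PiLp.smul_apply, smul_eq_mul, Fin.eta]
        field_simp
    -- Here `NR ≤ j`, and the rank is at most `NR`.
    · have h0 : σ j = 0 := by
        refine T.singularValues_eq_zero_iff_le_finrank_range.2 ((Submodule.finrank_le _).trans ?_)
        rw [finrank_euclideanSpace_fin]
        omega
      rw [hker j h0]
      refine (Finset.sum_eq_zero fun k _ => ?_).symm
      rw [Matrix.one_apply_ne, mul_zero]
      rintro rfl
      exact hj (lt_of_lt_of_le k.isLt (min_le_left _ _))
  rw [← key, Matrix.mul_assoc]
  change H = H * (V * star V)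
  rw [Matrix.mem_unitaryGroup_iff.1 hV, Matrix.mul_one]

/-- Antitone tuples of reals with the same multiset of entries are equal. -/
theorem eq_of_antitone_of_map_univ_eq {n : ℕ} {a b : Fin n → ℝ} (ha : Antitone a)
    (hb : Antitone b) (h : Finset.univ.val.map a = Finset.univ.val.map b) : a = b := by
  rw [← List.ofFn_inj]
  refine List.Perm.eq_of_sortedGE ha.sortedGE_ofFn hb.sortedGE_ofFn ?_
  rwa [Fin.univ_val_map, Fin.univ_val_map, Multiset.coe_eq_coe] at h

theorem conjTranspose_rectDiag_mul_self (s : Fin (min NR NT) → ℝ) :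
    (rectDiag s : Matrix (Fin NR) (Fin NT) ℂ)ᴴ * rectDiag s = Matrix.diagonal fun j : Fin NT =>
      (((if h : (j : ℕ) < NR then s ⟨j, lt_min h j.isLt⟩ else 0) ^ 2 : ℝ) : ℂ) := by
  ext i j
  rw [Matrix.mul_apply, Matrix.diagonal_apply]
  simp only [Matrix.conjTranspose_apply, rectDiag, Matrix.of_apply]
  by_cases hi : (i : ℕ) < NR
  · rw [Finset.sum_eq_single ⟨i, hi⟩]
    · by_cases hij : i = j
      · subst hij
        simp [hi, sq]
      · have : (i : ℕ) ≠ j := fun h => hij (Fin.ext h)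
        simp [hij, this]
    · intro k _ hk
      have : (k : ℕ) ≠ i := fun h => hk (Fin.ext h)
      simp [this]
    · simp
  · rw [Finset.sum_eq_zero]
    · simp [hi]
    · intro k _
      have : (k : ℕ) ≠ i := fun h => hi (h ▸ k.isLt)
      simp [this]

/-- The middle factor of a singular value decomposition is determined by the matrix. -/
theorem eq_sv_of_eq_mul_rectDiag_mul {H : Matrix (Fin NR) (Fin NT) ℂ}
    {U : Matrix (Fin NR) (Fin NR) ℂ} {V : Matrix (Fin NT) (Fin NT) ℂ}
    (hU : U ∈ Matrix.unitaryGroup (Fin NR) ℂ) (hV : V ∈ Matrix.unitaryGroup (Fin NT) ℂ)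
    {s : Fin (min NR NT) → ℝ} (hs0 : ∀ n, 0 ≤ s n) (hs : Antitone s)
    (hH : H = U * rectDiag s * Vᴴ) : s = sv H := by
  set T := Matrix.toEuclideanLin H with hT
  have hn : Module.finrank ℂ (EuclideanSpace ℂ (Fin NT)) = NT := finrank_euclideanSpace_fin
  -- Padding `s` with zeros to length `NT` makes the `a j ^ 2` the full list of eigenvalues of `Hᴴ *
  -- H`. Both lists are in descending order, so equal root multisets give equal entries.
  let a : Fin NT → ℝ := fun j => if h : (j : ℕ) < NR then s ⟨j, lt_min h j.isLt⟩ else 0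
  have ha0 : ∀ j, 0 ≤ a j := fun j => by
    dsimp only [a]
    split_ifs
    exacts [hs0 _, le_rfl]
  have ha : Antitone a := by
    intro i j hij
    dsimp only [a]
    split_ifs with h1 h2 h2
    · exact hs hij
    · exact absurd (lt_of_le_of_lt (Fin.le_def.1 hij) ‹_›) ‹_›
    · exact hs0 _
    · exact le_rfl
  have hUU : Uᴴ * U = 1 := Matrix.mem_unitaryGroup_iff'.1 hU
  have hVV : Vᴴ * V = 1 := Matrix.mem_unitaryGroup_iff'.1 hV
  have hHH : Hᴴ * H = V * Matrix.diagonal (fun j => ((a j ^ 2 : ℝ) : ℂ)) * Vᴴ := by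
    rw [← conjTranspose_rectDiag_mul_self, hH]
    simp only [Matrix.conjTranspose_mul, Matrix.conjTranspose_conjTranspose, Matrix.mul_assoc]
    rw [← Matrix.mul_assoc Uᴴ, hUU, Matrix.one_mul]
  have hchar : (LinearMap.adjoint T ∘ₗ T).charpoly =
      ∏ j, (Polynomial.X - Polynomial.C ((a j ^ 2 : ℝ) : ℂ)) := by
    rw [hT, ← Matrix.toEuclideanLin_conjTranspose_eq_adjoint, Matrix.toEuclideanLin,
      ← Matrix.toLpLin_mul, Matrix.toLpLin_eq_toLin,
      Matrix.charpoly_toLin, hHH, Matrix.mul_assoc, Matrix.charpoly_mul_comm, Matrix.mul_assoc, hVV,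
      Matrix.mul_one, Matrix.charpoly_diagonal]
  have hroots := T.isSymmetric_adjoint_comp_self.roots_charpoly_eq_eigenvalues hn
  rw [hchar, Polynomial.roots_prod _ _
    (Finset.prod_ne_zero_iff.2 fun j _ => Polynomial.X_sub_C_ne_zero _)] at hroots
  have hmap := congrArg (Multiset.map Complex.re) hroots
  simp only [Polynomial.roots_X_sub_C, Multiset.bind_singleton, Multiset.map_map] at hmap
  have heq : (fun j => a j ^ 2) = T.isSymmetric_adjoint_comp_self.eigenvalues hn := by
    refine eq_of_antitone_of_map_univ_eq (fun i j hij => ?_)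
      (T.isSymmetric_adjoint_comp_self.eigenvalues_antitone hn) ?_
    · exact pow_le_pow_left₀ (ha0 j) (ha hij) 2
    · exact hmap
  ext n
  have h1 := congrFun heq (colIdx NR NT n)
  rw [← T.sq_singularValues_fin hn] at h1
  have h2 := (sq_eq_sq₀ (ha0 _) (T.singularValues_nonneg _)).1 h1
  have h3 : ((colIdx NR NT n : Fin NT) : ℕ) < NR := lt_of_lt_of_le n.isLt (min_le_left _ _)
  dsimp only [a] at h2
  rw [dif_pos h3] at h2
  exact h2

/-! ### The trace inequality and the trace pairing -/

variable {G L : ℕ}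

/-- The trace inequality: `U D Vᴴ`, with `D` carrying a vector of the dual unit ball, pairs with
`Z` to at most `f (sv Z)`. -/
theorem IsSymmetricGauge.re_trace_le {f : (Fin (min NR NT) → ℝ) → ℝ}
    (hf : IsSymmetricGauge f) {d : Fin (min NR NT) → ℝ} (hd : ∀ y, ∑ n, d n * y n ≤ f y)
    {U : Matrix (Fin NR) (Fin NR) ℂ} (hU : U ∈ Matrix.unitaryGroup (Fin NR) ℂ)
    {V : Matrix (Fin NT) (Fin NT) ℂ} (hV : V ∈ Matrix.unitaryGroup (Fin NT) ℂ)
    (Z : Matrix (Fin NR) (Fin NT) ℂ) :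
    (Matrix.trace ((U * rectDiag d * Vᴴ)ᴴ * Z)).re ≤ f (sv Z) := by
  obtain ⟨U', V', hU', hV', hZ⟩ := exists_isSVD Z
  have h := hf.re_trace_rectDiag_le hd (sv_nonneg Z)
    (mul_mem (Unitary.star_mem hU) hU') (mul_mem (Unitary.star_mem hV') hV)
  refine le_trans (le_of_eq ?_) h
  congr 1
  conv_lhs => rw [hZ]
  simp only [Matrix.conjTranspose_mul, Matrix.conjTranspose_conjTranspose,
    Matrix.star_eq_conjTranspose, Matrix.mul_assoc]
  rw [Matrix.trace_mul_comm]
  simp only [Matrix.mul_assoc]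

theorem IsSVD.re_trace_eq {H : Matrix (Fin NR) (Fin NT) ℂ}
    {U : Matrix (Fin NR) (Fin NR) ℂ} {V : Matrix (Fin NT) (Fin NT) ℂ} (h : IsSVD H U V)
    (d : Fin (min NR NT) → ℝ) :
    (Matrix.trace ((U * rectDiag d * Vᴴ)ᴴ * H)).re = ∑ n, d n * sv H n := by
  obtain ⟨hU, hV, hH⟩ := h
  have hUU : Uᴴ * U = 1 := Matrix.mem_unitaryGroup_iff'.1 hU
  have hVV : Vᴴ * V = 1 := Matrix.mem_unitaryGroup_iff'.1 hV
  have h1 : Matrix.trace ((U * rectDiag d * Vᴴ)ᴴ * H) =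
      Matrix.trace ((rectDiag d : Matrix (Fin NR) (Fin NT) ℂ)ᴴ * rectDiag (sv H)) := by
    conv_lhs => rw [hH]
    simp only [Matrix.conjTranspose_mul, Matrix.conjTranspose_conjTranspose, Matrix.mul_assoc]
    rw [← Matrix.mul_assoc Uᴴ, hUU, Matrix.one_mul, Matrix.trace_mul_comm]
    simp only [Matrix.mul_assoc, hVV, Matrix.mul_one]
  rw [h1, trace_conjTranspose_rectDiag_mul, Complex.re_sum]
  refine Finset.sum_congr rfl fun n _ => ?_
  rw [rectDiag_apply_idx, ← Complex.ofReal_mul, Complex.ofReal_re]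

/-- `U D Vᴴ` is a subgradient of `f ∘ sv` at `H`. -/
theorem IsSymmetricGauge.add_re_trace_le {f : (Fin (min NR NT) → ℝ) → ℝ}
    (hf : IsSymmetricGauge f) {H : Matrix (Fin NR) (Fin NT) ℂ}
    {U : Matrix (Fin NR) (Fin NR) ℂ} {V : Matrix (Fin NT) (Fin NT) ℂ} (h : IsSVD H U V)
    {d : Fin (min NR NT) → ℝ} (hd : d ∈ vecSubdifferential f (sv H))
    (Z : Matrix (Fin NR) (Fin NT) ℂ) :
    f (sv H) + (Matrix.trace ((U * rectDiag d * Vᴴ)ᴴ * Z)).re ≤ f (sv (H + Z)) := by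
  rw [hf.mem_vecSubdifferential_iff] at hd
  have h1 := hf.re_trace_le hd.1 h.1 h.2.1 (H + Z)
  rwa [Matrix.mul_add, Matrix.trace_add, Complex.add_re, h.re_trace_eq, hd.2] at h1

/-- Pairing with `B X F` is pairing with the adjoint image. -/
theorem trace_conjTranspose_mul_mul {l p : ℕ} (B : Matrix (Fin NR) (Fin l) ℂ)
    (F : Matrix (Fin p) (Fin NT) ℂ) (M : Matrix (Fin NR) (Fin NT) ℂ)
    (X : Matrix (Fin l) (Fin p) ℂ) :
    Matrix.trace ((Bᴴ * M * Fᴴ)ᴴ * X) = Matrix.trace (Mᴴ * (B * X * F)) := by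
  simp only [Matrix.conjTranspose_mul, Matrix.conjTranspose_conjTranspose]
  rw [Matrix.mul_assoc, Matrix.trace_mul_comm]
  simp only [Matrix.mul_assoc]

theorem convex_matSubdifferential {m n : ℕ} (F : Matrix (Fin m) (Fin n) ℂ → ℝ)
    (A : Matrix (Fin m) (Fin n) ℂ) : Convex ℝ (matSubdifferential F A) := by
  intro S hS T hT a b ha hb hab X
  have h1 := mul_le_mul_of_nonneg_left (hS X) ha
  have h2 := mul_le_mul_of_nonneg_left (hT X) hb
  have h3 : (Matrix.trace ((a • S + b • T)ᴴ * (X - A))).re =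
      a * (Matrix.trace (Sᴴ * (X - A))).re + b * (Matrix.trace (Tᴴ * (X - A))).re := by
    rw [Matrix.conjTranspose_add, Matrix.conjTranspose_smul, Matrix.conjTranspose_smul,
      Matrix.add_mul, Matrix.smul_mul, Matrix.smul_mul, Matrix.trace_add, Matrix.trace_smul,
      Matrix.trace_smul]
    simp
  have h4 : F A = a * F A + b * F A := by rw [← add_mul, hab, one_mul]
  have h5 : F X = a * F X + b * F X := by rw [← add_mul, hab, one_mul]
  rw [h3]
  linarith

/-- A real-linear functional on complex matrices is a trace pairing. -/
theorem exists_re_trace_eq {m n : ℕ} (φ : Matrix (Fin m) (Fin n) ℂ →ₗ[ℝ] ℝ) :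
    ∃ Y : Matrix (Fin m) (Fin n) ℂ, ∀ S, φ S = (Matrix.trace (Sᴴ * Y)).re := by
  refine ⟨Matrix.of fun i j =>
    ⟨φ (Matrix.single i j 1), φ (Matrix.single i j Complex.I)⟩, fun S => ?_⟩
  have hS : ∀ i j, φ (Matrix.single i j (S i j)) =
      (S i j).re * φ (Matrix.single i j 1) + (S i j).im * φ (Matrix.single i j Complex.I) := by
    intro i j
    rw [← smul_eq_mul, ← smul_eq_mul, ← map_smul, ← map_smul, ← map_add, Matrix.smul_single,
      Matrix.smul_single, ← Matrix.single_add]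
    congr 2
    apply Complex.ext <;> simp
  conv_lhs => rw [Matrix.matrix_eq_sum_single S]
  simp only [map_sum, hS, Matrix.trace, Matrix.diag_apply, Matrix.mul_apply, Complex.re_sum]
  rw [Finset.sum_comm]
  refine Finset.sum_congr rfl fun j _ => Finset.sum_congr rfl fun i _ => ?_
  simp [Complex.mul_re]

/-! ### Compactness, limits and the subdifferential of the affine composite -/

/-- The triples `(U, V, d)` that give the subgradients at `H`. -/
theorem isCompact_svdTriples {f : (Fin (min NR NT) → ℝ) → ℝ} (hf : IsSymmetricGauge f)
    (H : Matrix (Fin NR) (Fin NT) ℂ) :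
    IsCompact {p : Matrix (Fin NR) (Fin NR) ℂ × Matrix (Fin NT) (Fin NT) ℂ ×
      (Fin (min NR NT) → ℝ) | IsSVD H p.1 p.2.1 ∧ p.2.2 ∈ vecSubdifferential f (sv H)} := by
  have hset : {p : Matrix (Fin NR) (Fin NR) ℂ × Matrix (Fin NT) (Fin NT) ℂ ×
      (Fin (min NR NT) → ℝ) | IsSVD H p.1 p.2.1 ∧ p.2.2 ∈ vecSubdifferential f (sv H)} =
      ((Matrix.unitaryGroup (Fin NR) ℂ : Set (Matrix (Fin NR) (Fin NR) ℂ)) ×ˢ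
        (Matrix.unitaryGroup (Fin NT) ℂ : Set (Matrix (Fin NT) (Fin NT) ℂ)) ×ˢ
        {d | ∀ y, ∑ n, d n * y n ≤ f y}) ∩
      {p : Matrix (Fin NR) (Fin NR) ℂ × Matrix (Fin NT) (Fin NT) ℂ × (Fin (min NR NT) → ℝ) |
        H = p.1 * rectDiag (sv H) * p.2.1ᴴ ∧ ∑ n, p.2.2 n * sv H n = f (sv H)} := by
    ext ⟨U, V, d⟩
    simp only [IsSVD, hf.mem_vecSubdifferential_iff, Set.mem_ofPred_eq, Set.mem_inter_iff,
      Set.mem_prod, SetLike.mem_coe]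
    tauto
  rw [hset]
  refine ((isCompact_unitaryGroup NR).prod
    ((isCompact_unitaryGroup NT).prod hf.isCompact_dualBall)).inter_right ?_
  exact (isClosed_eq continuous_const (by fun_prop)).inter
    (isClosed_eq (by fun_prop) continuous_const)

/-- Limits of singular value decompositions and of subgradients of `f` along a convergent
sequence of matrices, after passing to a subsequence. -/
theorem exists_subseq_svd {f : (Fin (min NR NT) → ℝ) → ℝ} (hf : IsSymmetricGauge f)
    {H : Matrix (Fin NR) (Fin NT) ℂ} {Hs : ℕ → Matrix (Fin NR) (Fin NT) ℂ}
    (hlim : Filter.Tendsto Hs Filter.atTop (nhds H))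
    {U : ℕ → Matrix (Fin NR) (Fin NR) ℂ} {V : ℕ → Matrix (Fin NT) (Fin NT) ℂ}
    {d : ℕ → Fin (min NR NT) → ℝ} (hsvd : ∀ k, IsSVD (Hs k) (U k) (V k))
    (hd : ∀ k, d k ∈ vecSubdifferential f (sv (Hs k))) :
    ∃ U₀ V₀ d₀, IsSVD H U₀ V₀ ∧ d₀ ∈ vecSubdifferential f (sv H) ∧ ∃ κ : ℕ → ℕ,
      Filter.Tendsto (fun k => U (κ k) * rectDiag (d (κ k)) * (V (κ k))ᴴ) Filter.atTop
        (nhds (U₀ * rectDiag d₀ * V₀ᴴ)) := by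
  have hd' := fun k => hf.mem_vecSubdifferential_iff.1 (hd k)
  have : ∀ m n : ℕ, FirstCountableTopology (Matrix (Fin m) (Fin n) ℂ) := fun m n =>
    inferInstanceAs (FirstCountableTopology (Fin m → Fin n → ℂ))
  obtain ⟨⟨U₀, V₀, d₀⟩, ⟨hU₀, hV₀, hd₀⟩, κ, hκ, hconv⟩ :=
    ((isCompact_unitaryGroup NR).prod
      ((isCompact_unitaryGroup NT).prod hf.isCompact_dualBall)).tendsto_subseq
      (x := fun k => (U k, V k, d k)) fun k => ⟨(hsvd k).1, (hsvd k).2.1, (hd' k).1⟩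
  have hUlim : Filter.Tendsto (fun k => U (κ k)) Filter.atTop (nhds U₀) :=
    (continuous_fst.tendsto _).comp hconv
  have hVlim : Filter.Tendsto (fun k => V (κ k)) Filter.atTop (nhds V₀) :=
    ((continuous_fst.comp continuous_snd).tendsto _).comp hconv
  have hdlim : Filter.Tendsto (fun k => d (κ k)) Filter.atTop (nhds d₀) :=
    ((continuous_snd.comp continuous_snd).tendsto _).comp hconv
  have hHlim : Filter.Tendsto (fun k => Hs (κ k)) Filter.atTop (nhds H) :=
    hlim.comp hκ.tendsto_atTop
  -- Continuity of `sv` is not needed: the singular values are the diagonal of `Uᴴ H V`, which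
  -- converges with its factors. Uniqueness of the middle factor then identifies the limit with `sv
  -- H`.
  let s : Fin (min NR NT) → ℝ := fun n =>
    ((U₀ᴴ * H * V₀) (rowIdx NR NT n) (colIdx NR NT n)).re
  have hs : Filter.Tendsto (fun k => sv (Hs (κ k))) Filter.atTop (nhds s) := by
    refine tendsto_pi_nhds.2 fun n => ?_
    have hc : Continuous fun p : Matrix (Fin NR) (Fin NR) ℂ × Matrix (Fin NR) (Fin NT) ℂ ×
        Matrix (Fin NT) (Fin NT) ℂ =>
        ((p.1ᴴ * p.2.1 * p.2.2) (rowIdx NR NT n) (colIdx NR NT n)).re := by fun_prop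
    have h1 := (hc.tendsto (U₀, H, V₀)).comp
      (hUlim.prodMk_nhds (hHlim.prodMk_nhds hVlim))
    refine h1.congr fun k => ?_
    obtain ⟨hU, hV, hH⟩ := hsvd (κ k)
    have hUU : (U (κ k))ᴴ * U (κ k) = 1 := Matrix.mem_unitaryGroup_iff'.1 hU
    have hVV : (V (κ k))ᴴ * V (κ k) = 1 := Matrix.mem_unitaryGroup_iff'.1 hV
    have h2 : (U (κ k))ᴴ * Hs (κ k) * V (κ k) = rectDiag (sv (Hs (κ k))) := by
      conv_lhs => rw [hH]
      simp only [Matrix.mul_assoc, hVV, Matrix.mul_one]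
      rw [← Matrix.mul_assoc, hUU, Matrix.one_mul]
    simp only [Function.comp_apply, h2, rectDiag_apply_idx, Complex.ofReal_re]
  have hrec : Continuous fun p : Matrix (Fin NR) (Fin NR) ℂ × (Fin (min NR NT) → ℝ) ×
      Matrix (Fin NT) (Fin NT) ℂ => p.1 * rectDiag p.2.1 * p.2.2ᴴ := by
    have := continuous_rectDiag (NR := NR) (NT := NT)
    fun_prop
  have hH : H = U₀ * rectDiag s * V₀ᴴ := by
    refine tendsto_nhds_unique hHlim ?_
    refine ((hrec.tendsto (U₀, s, V₀)).comp
      (hUlim.prodMk_nhds (hs.prodMk_nhds hVlim))).congr fun k => ?_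
    exact (hsvd (κ k)).2.2.symm
  have hs0 : ∀ n, 0 ≤ s n := fun n =>
    ge_of_tendsto' (tendsto_pi_nhds.1 hs n) fun k => sv_nonneg _ n
  have hsa : Antitone s := fun i j hij =>
    le_of_tendsto_of_tendsto' (tendsto_pi_nhds.1 hs j) (tendsto_pi_nhds.1 hs i)
      fun k => sv_antitone _ hij
  have hsv : s = sv H := eq_sv_of_eq_mul_rectDiag_mul hU₀ hV₀ hs0 hsa hH
  refine ⟨U₀, V₀, d₀, ⟨hU₀, hV₀, hsv ▸ hH⟩, ?_, κ, ?_⟩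
  · refine hf.mem_vecSubdifferential_iff.2 ⟨hd₀, ?_⟩
    rw [← hsv]
    have h1 : Filter.Tendsto (fun k => ∑ n, d (κ k) n * sv (Hs (κ k)) n) Filter.atTop
        (nhds (∑ n, d₀ n * s n)) :=
      tendsto_finsetSum _ fun n _ => (tendsto_pi_nhds.1 hdlim n).mul (tendsto_pi_nhds.1 hs n)
    have h2 : Filter.Tendsto (fun k => f (sv (Hs (κ k)))) Filter.atTop (nhds (f s)) :=
      (hf.continuous.tendsto s).comp hs
    exact tendsto_nhds_unique h1 (h2.congr fun k => (hd' (κ k)).2.symm)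
  · have h3 := (hrec.tendsto (U₀, d₀, V₀)).comp
      (hUlim.prodMk_nhds (hdlim.prodMk_nhds hVlim))
    simpa only [Function.comp_def] using h3

/-- The subdifferential of `X ↦ f (sv (H + B (X - A) F))` at `A`. -/
theorem IsSymmetricGauge.matSubdifferential_affine {f : (Fin (min NR NT) → ℝ) → ℝ}
    (hf : IsSymmetricGauge f) {l p : ℕ} (H : Matrix (Fin NR) (Fin NT) ℂ)
    (B : Matrix (Fin NR) (Fin l) ℂ) (F : Matrix (Fin p) (Fin NT) ℂ)
    (A : Matrix (Fin l) (Fin p) ℂ) :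
    matSubdifferential (fun X => f (sv (H + B * (X - A) * F))) A =
      convexHull ℝ {S | ∃ U V d, IsSVD H U V ∧ d ∈ vecSubdifferential f (sv H) ∧
        S = Bᴴ * U * rectDiag d * Vᴴ * Fᴴ} := by
  set K : Set (Matrix (Fin l) (Fin p) ℂ) :=
    {S | ∃ U V d, IsSVD H U V ∧ d ∈ vecSubdifferential f (sv H) ∧
        S = Bᴴ * U * rectDiag d * Vᴴ * Fᴴ}
  have hassoc : ∀ (U : Matrix (Fin NR) (Fin NR) ℂ) (V : Matrix (Fin NT) (Fin NT) ℂ)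
      (d : Fin (min NR NT) → ℝ),
      Bᴴ * U * rectDiag d * Vᴴ * Fᴴ = Bᴴ * (U * rectDiag d * Vᴴ) * Fᴴ := fun U V d => by
    simp only [Matrix.mul_assoc]
  apply Set.Subset.antisymm
  · intro S hS
    by_contra hSK
    have hKc : IsCompact K := by
      have hc : Continuous fun q : Matrix (Fin NR) (Fin NR) ℂ × Matrix (Fin NT) (Fin NT) ℂ ×
          (Fin (min NR NT) → ℝ) => Bᴴ * q.1 * rectDiag q.2.2 * q.2.1ᴴ * Fᴴ := by
        have := continuous_rectDiag (NR := NR) (NT := NT)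
        fun_prop
      convert (isCompact_svdTriples hf H).image hc
      ext S
      constructor
      · rintro ⟨U, V, d, h1, h2, rfl⟩
        exact ⟨(U, V, d), ⟨h1, h2⟩, rfl⟩
      · rintro ⟨⟨U, V, d⟩, ⟨h1, h2⟩, rfl⟩
        exact ⟨U, V, d, h1, h2, rfl⟩
    have : LocallyConvexSpace ℝ (Matrix (Fin l) (Fin p) ℂ) :=
      inferInstanceAs (LocallyConvexSpace ℝ (Fin l → Fin p → ℂ))
    obtain ⟨φ, u, hu, huS⟩ := geometric_hahn_banach_closed_point (convex_convexHull ℝ K)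
      (isCompact_convexHull hKc).isClosed hSK
    obtain ⟨Y, hY⟩ := exists_re_trace_eq (φ : Matrix (Fin l) (Fin p) ℂ →ₗ[ℝ] ℝ)
    have hY' : ∀ T, φ T = (Matrix.trace (Tᴴ * Y)).re := hY
    set Z := B * Y * F with hZ
    let t : ℕ → ℝ := fun k => 1 / ((k : ℝ) + 1)
    have ht0 : ∀ k, 0 < t k := fun k => by positivity
    have ht : Filter.Tendsto t Filter.atTop (nhds 0) := tendsto_one_div_add_atTop_nhds_zero_nat
    let Hs : ℕ → Matrix (Fin NR) (Fin NT) ℂ := fun k => H + t k • Z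
    have hHs : Filter.Tendsto Hs Filter.atTop (nhds H) := by
      have hc : Continuous fun r : ℝ => H + r • Z := by fun_prop
      have h0 := (hc.tendsto 0).comp ht
      rwa [zero_smul, add_zero] at h0
    choose U V hsvd using fun k => exists_isSVD (Hs k)
    choose d hd using fun k => hf.vecSubdifferential_nonempty (sv (Hs k))
    obtain ⟨U₀, V₀, d₀, h1, h2, κ, hκ⟩ := exists_subseq_svd hf hHs hsvd hd
    -- Both sides, multiplied by `t k`, enclose `f (sv (Hs k)) - f (sv H)`: `S` bounds it below by
    -- the step `t k • Y` from `A`, and the subgradient at `Hs k` bounds it above by the step `-(t k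
    -- • Z)` back to `H`.
    have hle : ∀ k, φ S ≤ φ (Bᴴ * (U k * rectDiag (d k) * (V k)ᴴ) * Fᴴ) := by
      intro k
      have h3 : f (sv (H + B * (A - A) * F)) +
          (Matrix.trace (Sᴴ * (A + t k • Y - A))).re ≤
            f (sv (H + B * (A + t k • Y - A) * F)) := hS (A + t k • Y)
      have h4 := hf.add_re_trace_le (hsvd k) (hd k) (-(t k • Z))
      have h5 : Hs k + -(t k • Z) = H := by simp [Hs]
      have h6 : H + B * (A + t k • Y - A) * F = Hs k := by
        simp [Hs, hZ, Matrix.mul_assoc]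
      have h7 : H + B * (A - A) * F = H := by simp
      rw [h6, h7, add_sub_cancel_left] at h3
      simp only [Matrix.mul_smul, Matrix.trace_smul,
        Complex.smul_re, smul_eq_mul] at h3
      rw [h5] at h4
      simp only [Matrix.mul_neg, Matrix.mul_smul, Matrix.trace_neg, Matrix.trace_smul,
        Complex.neg_re, Complex.smul_re, smul_eq_mul] at h4
      rw [hY', hY', trace_conjTranspose_mul_mul]
      refine le_of_mul_le_mul_left ?_ (ht0 k)
      rw [← hZ]
      linarith
    have hlimit : φ S ≤ φ (Bᴴ * (U₀ * rectDiag d₀ * V₀ᴴ) * Fᴴ) := by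
      have hc : Continuous fun M : Matrix (Fin NR) (Fin NT) ℂ => φ (Bᴴ * M * Fᴴ) :=
        φ.continuous.comp (by fun_prop)
      exact ge_of_tendsto' ((hc.tendsto _).comp hκ) fun k => hle (κ k)
    have hmem : Bᴴ * (U₀ * rectDiag d₀ * V₀ᴴ) * Fᴴ ∈ K :=
      ⟨U₀, V₀, d₀, h1, h2, (hassoc _ _ _).symm⟩
    exact absurd (hu _ (subset_convexHull ℝ K hmem)) (not_lt.2 (huS.le.trans hlimit))
  · refine convexHull_min ?_ (convex_matSubdifferential _ _)
    rintro _ ⟨U, V, d, h1, h2, rfl⟩ X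
    rw [hassoc, trace_conjTranspose_mul_mul]
    simpa using hf.add_re_trace_le h1 h2 (B * (X - A) * F)

/-! ### Reduction to a single block -/

theorem scattering_apply (Θ : Fin G → Matrix (Fin L) (Fin L) ℂ) (b g : Fin G) (k l : Fin L) :
    scattering Θ (finProdFinEquiv (b, k)) (finProdFinEquiv (g, l)) =
      if b = g then Θ b k l else 0 := by
  simp only [scattering, Matrix.of_apply, Equiv.symm_apply_apply]

theorem mul_scattering_mul (HB : Matrix (Fin NR) (Fin (G * L)) ℂ)
    (HF : Matrix (Fin (G * L)) (Fin NT) ℂ) (Θ : Fin G → Matrix (Fin L) (Fin L) ℂ) :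
    HB * scattering Θ * HF = ∑ g, backward HB g * Θ g * forward HF g := by
  ext i j
  rw [Matrix.sum_apply, Matrix.mul_apply, ← finProdFinEquiv.sum_comp, Fintype.sum_prod_type]
  refine Finset.sum_congr rfl fun g _ => ?_
  rw [Matrix.mul_apply]
  refine Finset.sum_congr rfl fun l _ => ?_
  rw [Matrix.mul_apply, Matrix.mul_apply, ← finProdFinEquiv.sum_comp, Fintype.sum_prod_type,
    Finset.sum_eq_single g]
  · simp [scattering_apply, backward, forward]
  · intro b _ hb
    simp [scattering_apply, hb]
  · simp

/-- This puts the channel, as a function of one block, in the affine form of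
`matSubdifferential_affine`: only the `g`-th summand of the block expansion changes. -/
theorem channel_update (HD : Matrix (Fin NR) (Fin NT) ℂ)
    (HB : Matrix (Fin NR) (Fin (G * L)) ℂ) (HF : Matrix (Fin (G * L)) (Fin NT) ℂ)
    (Θ : Fin G → Matrix (Fin L) (Fin L) ℂ) (g : Fin G) (X : Matrix (Fin L) (Fin L) ℂ) :
    channel HD HB HF (Function.update Θ g X) =
      channel HD HB HF Θ + backward HB g * (X - Θ g) * forward HF g := by
  have h : ∑ b, backward HB b * Function.update Θ g X b * forward HF b =
      ∑ b, backward HB b * Θ b * forward HF b +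
        backward HB g * (X - Θ g) * forward HF g := by
    rw [← sub_eq_iff_eq_add', ← Finset.sum_sub_distrib, Finset.sum_eq_single g]
    · simp [Matrix.mul_sub, Matrix.sub_mul]
    · intro b _ hb
      simp [Function.update_of_ne hb]
    · simp
  simp only [channel, mul_scattering_mul, h, add_assoc]

end RISShaping

theorem mainTheorem9 {NR NT G L : ℕ} (HD : Matrix (Fin NR) (Fin NT) ℂ)
    (HB : Matrix (Fin NR) (Fin (G * L)) ℂ) (HF : Matrix (Fin (G * L)) (Fin NT) ℂ)
    (f : (Fin (min NR NT) → ℝ) → ℝ) (hf : RISShaping.IsSymmetricGauge f)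
    (Θ : Fin G → Matrix (Fin L) (Fin L) ℂ) (g : Fin G) :
    RISShaping.matSubdifferential
        (fun X : Matrix (Fin L) (Fin L) ℂ =>
          f (RISShaping.sv (RISShaping.channel HD HB HF (Function.update Θ g X)))) (Θ g) =
      convexHull ℝ
        {S | ∃ (U : Matrix (Fin NR) (Fin NR) ℂ) (V : Matrix (Fin NT) (Fin NT) ℂ)
            (d : Fin (min NR NT) → ℝ),
          RISShaping.IsSVD (RISShaping.channel HD HB HF Θ) U V ∧
          d ∈ RISShaping.vecSubdifferential f
            (RISShaping.sv (RISShaping.channel HD HB HF Θ)) ∧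
          S = (RISShaping.backward HB g)ᴴ * U * RISShaping.rectDiag d * Vᴴ *
            (RISShaping.forward HF g)ᴴ} := by
  simp only [RISShaping.channel_update]
  exact hf.matSubdifferential_affine _ _ _ _
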